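/- Let $G$ be a discrete group acting by $\alpha$ on a (not necessarily unital) C*-algebra $A$ by $*$-automorphisms, let $A^\alpha$ be the fixed point algebra, and let $(\pi,u,H)$ be a covariant representation of $(G,A,\alpha)$ on a complex Hilbert space $H$, i.e. $\pi:A\to B(H)$ is a $*$-homomorphism and $u$ is a unitary representation of $G$ with $u_t\pi(a)u_t^*=\pi(\alpha_t(a))$. Let $G$ act on $B(H)$ by $x\mapsto u_gxu_g^*$; a $G$-map is a unital completely positive $G$-equivariant linear map. Let $\mathfrak M$ be the set of $G$-maps $\phi:B(H)\to B(H)$ with $\phi=\mathrm{id}$ on $\pi(A^\alpha)$, preordered by $\psi\le\phi\iff\|\psi(x)\|\le\|\phi(x)\|$ for all $x\in B(H)$. The boundary $\mathcal B_{\pi,u}$ is the image of a minimal element of $\mathfrak M$, with the restricted action of $G$. A normal subgroup $\Lambda\unlhd G$ is called $(\pi,u)$-amenable (for short, $u$-amenable) if there is a $G$-map $\phi:B(H)\to u(\Lambda)'$ (commutant in $B(H)$) with $\phi=\mathrm{id}$ on $\pi(A^\alpha)$. Then $\mathfrak M$ has a minimal element, and for every choice of minimal element defining $\mathcal B_{\pi,u}$: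 a normal subgroup $\Lambda\unlhd G$ acts trivially on $\mathcal B_{\pi,u}$ if and only if $\Lambda$ is $(\pi,u)$-amenable. Consequently the kernel of the action of $G$ on $\mathcal B_{\pi,u}$ is a $(\pi,u)$-amenable normal subgroup that contains every $(\pi,u)$-amenable normal subgroup of $G$; it is the unique maximal $(\pi,u)$-amenable normal subgroup, i.e. the $(\pi,u)$-amenable radical $\mathrm{Rad}_{\pi,u}(G)$. -/

import Mathlib

open scoped CStarAlgebra

/-- A covariant representation `(π, u, H)` of the C*-dynamical system `(G, A, α)`, where `G` is a
discrete group and `A` is a C*-algebra that need not be unital. -/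
structure CovariantRep {G A : Type*} [Group G] [NonUnitalCStarAlgebra A]
    (α : G →* (A ≃⋆ₐ[ℂ] A)) (H : Type*) [NormedAddCommGroup H] [InnerProductSpace ℂ H]
    [CompleteSpace H] where
  /-- The representation of the C*-algebra. -/
  π : A →⋆ₙₐ[ℂ] (H →L[ℂ] H)
  /-- The unitary representation of the group. -/
  u : G →* unitary (H →L[ℂ] H)
  covariant : ∀ (t : G) (a : A),
    (u t : H →L[ℂ] H) * π a * star (u t : H →L[ℂ] H) = π (α t a)

namespace CovariantRep

variable {G A : Type*} [Group G] [NonUnitalCStarAlgebra A] {α : G →* (A ≃⋆ₐ[ℂ] A)}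
  {H : Type*} [NormedAddCommGroup H] [InnerProductSpace ℂ H] [CompleteSpace H]

/-- The action `Ad_u` of `G` on `B(H)`: `g` sends `x` to `u_g x u_g*`. -/
noncomputable def Ad (c : CovariantRep α H) (g : G) (x : H →L[ℂ] H) : H →L[ℂ] H :=
  (c.u g : H →L[ℂ] H) * x * star (c.u g : H →L[ℂ] H)

/-- The image `π(A^α)` of the fixed point algebra of the action `α`. -/
def fixedImage (c : CovariantRep α H) : Set (H →L[ℂ] H) :=
  {x | ∃ a : A, (∀ t : G, α t a = a) ∧ c.π a = x}

/-- A completely positive map `B(H) → B(H)` is a `G`-map if it is unital and `G`-equivariant. -/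
def IsGMap (c : CovariantRep α H) (φ : (H →L[ℂ] H) →CP (H →L[ℂ] H)) : Prop :=
  φ 1 = 1 ∧ ∀ (g : G) (x : H →L[ℂ] H), φ (c.Ad g x) = c.Ad g (φ x)

/-- The set `𝔐` of all `G`-maps on `B(H)` that are the identity on `π(A^α)`. -/
def gMaps (c : CovariantRep α H) : Set ((H →L[ℂ] H) →CP (H →L[ℂ] H)) :=
  {φ | c.IsGMap φ ∧ ∀ x ∈ c.fixedImage, φ x = x}

/-- `φ` is a minimal element of `𝔐`, for the preorder in which `ψ` is below `φ` when
`‖ψ x‖ ≤ ‖φ x‖` for all `x`. -/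
def IsMinimalGMap (c : CovariantRep α H) (φ : (H →L[ℂ] H) →CP (H →L[ℂ] H)) : Prop :=
  φ ∈ c.gMaps ∧ ∀ ψ ∈ c.gMaps, (∀ x, ‖ψ x‖ ≤ ‖φ x‖) → ∀ x, ‖φ x‖ ≤ ‖ψ x‖

/-- The image of `φ`. For a minimal element `φ` of `𝔐` this is the
Furstenberg–Hamana boundary `𝓑_{π,u}`. -/
noncomputable def boundary (φ : (H →L[ℂ] H) →CP (H →L[ℂ] H)) : Submodule ℂ (H →L[ℂ] H) :=
  LinearMap.range φ.toLinearMap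

theorem Ad_one (c : CovariantRep α H) (x : H →L[ℂ] H) : c.Ad 1 x = x := by
  simp [Ad]

theorem Ad_mul (c : CovariantRep α H) (g h : G) (x : H →L[ℂ] H) :
    c.Ad (g * h) x = c.Ad g (c.Ad h x) := by
  simp [Ad, mul_assoc]

theorem Ad_mem_boundary (c : CovariantRep α H) {φ : (H →L[ℂ] H) →CP (H →L[ℂ] H)}
    (hφ : c.IsGMap φ) (g : G) {x : H →L[ℂ] H} (hx : x ∈ boundary φ) :
    c.Ad g x ∈ boundary φ := by
  obtain ⟨y, rfl⟩ := hx
  exact ⟨c.Ad g y, hφ.2 g y⟩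

/-- The action of `G` on the image of a `G`-map, obtained by restricting `Ad_u`. -/
noncomputable def boundaryAction (c : CovariantRep α H) (φ : (H →L[ℂ] H) →CP (H →L[ℂ] H))
    (hφ : c.IsGMap φ) : G →* Module.End ℂ (boundary φ) where
  toFun g :=
    { toFun := fun x => ⟨c.Ad g x, c.Ad_mem_boundary hφ g x.2⟩
      map_add' := fun x y => by
        ext1
        simp only [Ad, Submodule.coe_add, mul_add, add_mul]
      map_smul' := fun r x => by
        ext1
        simp only [Ad, Submodule.coe_smul, mul_smul_comm, smul_mul_assoc, RingHom.id_apply] }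
  map_one' := by
    ext1 x
    exact Subtype.ext (c.Ad_one x)
  map_mul' g h := by
    ext1 x
    exact Subtype.ext (c.Ad_mul g h x)

/-- The commutant `u(Λ)'` inside `B(H)`. -/
def commutant (c : CovariantRep α H) (Λ : Subgroup G) : Set (H →L[ℂ] H) :=
  Set.centralizer {x | ∃ g ∈ Λ, (c.u g : H →L[ℂ] H) = x}

/-- `Λ` is `(π, u)`-amenable: there is a `G`-map `B(H) → u(Λ)'` that is the identity
on `π(A^α)`. -/
def IsAmenable (c : CovariantRep α H) (Λ : Subgroup G) : Prop :=
  ∃ φ ∈ c.gMaps, ∀ x, φ x ∈ c.commutant Λ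

/-- The set of all `(π, u)`-amenable normal subgroups of `G`. -/
def amenableNormalSubgroups (c : CovariantRep α H) : Set (Subgroup G) :=
  {Λ | Λ.Normal ∧ c.IsAmenable Λ}

/-- `R` is the `(π, u)`-amenable radical `Rad_{π,u}(G)`: the unique maximal `(π, u)`-amenable
normal subgroup of `G`. -/
def IsAmenableRadical (c : CovariantRep α H) (R : Subgroup G) : Prop :=
  Maximal (· ∈ c.amenableNormalSubgroups) R ∧
    ∀ R', Maximal (· ∈ c.amenableNormalSubgroups) R' → R' = R

end CovariantRep

/-! Everything rests on rigidity. If `θ` in `𝔐` lies below a minimal `φ`, so do the Cesàro averages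
of its iterates. Minimality bounds `‖φ (x - θ x)‖` by the norm of an average that telescopes to
`O(1/n)`, hence `φ ∘ θ = φ`. Taking `θ = φ` makes `φ` idempotent; taking `θ = φ ∘ ψ ∘ φ` makes `φ ∘
ψ` the identity on the boundary for every `ψ` in `𝔐`. If `Λ` acts trivially, `φ` itself maps into
`u(Λ)'`. If some `ψ` in `𝔐` maps into `u(Λ)'`, then for `y` in the boundary and `g` in `Λ`, `Ad_g y
= φ (Ad_g (ψ y)) = φ (ψ y) = y`. Minimal elements come from Zorn's lemma: `𝔐` is closed under
point-weak ultrafilter limits, and these do not increase norms. -/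

/-! ### Positivity of operator matrices. -/

section BlockOperators

open scoped ComplexOrder

variable {H : Type*} [NormedAddCommGroup H] [InnerProductSpace ℂ H] [CompleteSpace H]

open ContinuousLinearMap in
theorem ContinuousLinearMap.exists_eq_adjoint_comp_self {T : H →L[ℂ] H} (hT : 0 ≤ T) :
    ∃ S : H →L[ℂ] H, T = adjoint S ∘L S :=
  CStarAlgebra.nonneg_iff_eq_star_mul_self.mp hT

open ContinuousLinearMap in
theorem PiLp.adjoint_proj_apply {n : Type*} [Fintype n] [DecidableEq n] (j : n) (x : H) :
    adjoint (PiLp.proj 2 (fun _ : n => H) j : PiLp 2 (fun _ : n => H) →L[ℂ] H) x =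
      WithLp.toLp 2 (Pi.single j x) := by
  refine ext_inner_right ℂ fun w => ?_
  rw [adjoint_inner_left, PiLp.inner_apply, Finset.sum_eq_single j]
  · simp
  · intro i _ hij
    simp [hij]
  · simp

namespace CStarMatrix

variable {n : Type*} [Fintype n]

open ContinuousLinearMap in
theorem inner_star_mul_self_apply (S : CStarMatrix n n (H →L[ℂ] H)) (i j : n) (x y : H) :
    inner ℂ y ((star S * S) i j x) = ∑ l, inner ℂ (S l i y) (S l j x) := by
  rw [CStarMatrix.mul_apply, sum_apply, inner_sum]
  refine Finset.sum_congr rfl fun l _ => ?_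
  exact adjoint_inner_right (S l i) _ _

theorem sum_inner_star_mul_self (S : CStarMatrix n n (H →L[ℂ] H)) (ξ : n → H) :
    ∑ i, ∑ j, inner ℂ (ξ i) ((star S * S) i j (ξ j)) =
      ∑ l, inner ℂ (∑ i, S l i (ξ i)) (∑ j, S l j (ξ j)) := by
  simp only [inner_star_mul_self_apply, inner_sum, sum_inner]
  rw [Finset.sum_comm_cycle]
  exact Finset.sum_congr rfl fun l _ => Finset.sum_comm

theorem sum_inner_nonneg {M : CStarMatrix n n (H →L[ℂ] H)} (hM : 0 ≤ M) (ξ : n → H) :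
    0 ≤ ∑ i, ∑ j, inner ℂ (ξ i) (M i j (ξ j)) := by
  rw [StarOrderedRing.nonneg_iff] at hM
  induction hM using AddSubmonoid.closure_induction with
  | mem M hM =>
    obtain ⟨S, rfl⟩ := hM
    simp only [sum_inner_star_mul_self]
    refine Finset.sum_nonneg fun l _ => ?_
    exact Complex.nonneg_iff.mpr
      ⟨inner_self_nonneg (𝕜 := ℂ), (inner_self_im (𝕜 := ℂ) _).symm⟩
  | zero => simp
  | add M N _ _ hM hN =>
    simpa [inner_add_right, Finset.sum_add_distrib] using add_nonneg hM hN

open ContinuousLinearMap in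
/-- A matrix of operators on a Hilbert space is nonnegative if and only if the associated
sesquilinear form is nonnegative. -/
theorem nonneg_iff_inner (M : CStarMatrix n n (H →L[ℂ] H)) :
    0 ≤ M ↔ ∀ ξ : n → H, 0 ≤ ∑ i, ∑ j, inner ℂ (ξ i) (M i j (ξ j)) := by
  classical
  refine ⟨sum_inner_nonneg, fun hM => ?_⟩
  let P : n → (PiLp 2 (fun _ : n => H) →L[ℂ] H) := fun i => PiLp.proj 2 (fun _ : n => H) i
  have hPP (i j : n) (x : H) : P i (adjoint (P j) x) = if i = j then x else 0 := by
    rw [PiLp.adjoint_proj_apply]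
    by_cases hij : i = j
    · subst hij; simp [P]
    · simp [P, hij]
  have hsum (v w : PiLp 2 (fun _ : n => H)) : inner ℂ v w = ∑ l, inner ℂ (P l v) (P l w) := by
    rw [PiLp.inner_apply]
    rfl
  -- `M` realized as one operator on the Hilbert sum `H^n`; the blocks of a factor `S` with `T = S*
  -- S` then give `M = N* N`.
  let T : PiLp 2 (fun _ : n => H) →L[ℂ] PiLp 2 (fun _ : n => H) :=
    ∑ i, ∑ j, adjoint (P i) ∘L M i j ∘L P j
  have hT : 0 ≤ T := by
    rw [nonneg_iff_isPositive, isPositive_iff_complex]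
    intro v
    have h := hM fun i => P i v
    have h' : inner ℂ (T v) v = starRingEnd ℂ (∑ i, ∑ j, inner ℂ (P i v) (M i j (P j v))) := by
      simp only [T, sum_apply, sum_inner, comp_apply, adjoint_inner_left, map_sum,
        inner_conj_symm]
    rw [h']
    generalize ∑ i, ∑ j, inner ℂ (P i v) (M i j (P j v)) = z at h
    obtain ⟨h1, h2⟩ := Complex.nonneg_iff.mp h
    exact ⟨Complex.ext (by simp) (by simp [← h2]), by simpa using h1⟩
  obtain ⟨S, hS⟩ := exists_eq_adjoint_comp_self hT
  let N : CStarMatrix n n (H →L[ℂ] H) :=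
    CStarMatrix.ofMatrix fun i j => P i ∘L S ∘L adjoint (P j)
  suffices h : M = star N * N by
    rw [h]; exact star_mul_self_nonneg N
  ext i j x
  refine ext_inner_left ℂ fun y => ?_
  have h1 : inner ℂ y (M i j x) = inner ℂ (adjoint (P i) y) (T (adjoint (P j) x)) := by
    simp only [T, sum_apply, comp_apply, inner_sum, adjoint_inner_right, hPP]
    rw [Finset.sum_eq_single i, Finset.sum_eq_single j] <;> simp +contextual
  rw [h1, hS, inner_star_mul_self_apply, comp_apply, adjoint_inner_right, hsum]
  rfl

end CStarMatrix

end BlockOperators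

/-! ### Weak operator limits along ultrafilters. -/

section WeakOperatorLimits

open Filter Topology

variable {H : Type*} [NormedAddCommGroup H] [InnerProductSpace ℂ H]

/-- Testing at `ξ = S η` bounds `‖S η‖²` by `‖S η‖ * (C * ‖η‖)`. -/
theorem ContinuousLinearMap.norm_le_of_tendsto_inner {ι : Type*} {F : Filter ι} [F.NeBot]
    {T : ι → H →L[ℂ] H} {S : H →L[ℂ] H} {C : ℝ} (hC : 0 ≤ C)
    (hT : ∀ᶠ i in F, ‖T i‖ ≤ C)
    (h : ∀ ξ η, Tendsto (fun i => (inner ℂ ξ (T i η) : ℂ)) F (𝓝 (inner ℂ ξ (S η)))) :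
    ‖S‖ ≤ C := by
  refine S.opNorm_le_bound hC fun η => ?_
  have h1 : ‖(inner ℂ (S η) (S η) : ℂ)‖ ≤ ‖S η‖ * (C * ‖η‖) := by
    refine le_of_tendsto (h (S η) η).norm ?_
    filter_upwards [hT] with i hi
    refine (norm_inner_le_norm _ _).trans ?_
    gcongr
    exact (T i).le_of_opNorm_le hi η
  rw [inner_self_eq_norm_sq_to_K, norm_pow, RCLike.norm_ofReal, abs_norm, sq] at h1
  rcases (norm_nonneg (S η)).eq_or_lt' with h0 | h0
  · rw [h0]; positivity
  · exact le_of_mul_le_mul_left h1 h0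

/-- Bounded families of operators on a Hilbert space converge in the weak operator topology along
every ultrafilter. -/
theorem ContinuousLinearMap.exists_tendsto_inner_of_ultrafilter [CompleteSpace H] {ι : Type*}
    (F : Ultrafilter ι) {T : ι → H →L[ℂ] H} {C : ℝ} (hT : ∀ i, ‖T i‖ ≤ C) :
    ∃ S : H →L[ℂ] H,
      ∀ ξ η, Tendsto (fun i => (inner ℂ ξ (T i η) : ℂ)) F (𝓝 (inner ℂ ξ (S η))) := by
  have hbound (v w : H) (i : ι) : ‖(inner ℂ (T i v) w : ℂ)‖ ≤ C * ‖v‖ * ‖w‖ :=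
    (norm_inner_le_norm _ _).trans <| by
      gcongr
      exact (T i).le_of_opNorm_le (hT i) v
  have hlim (v w : H) : ∃ z : ℂ, Tendsto (fun i => (inner ℂ (T i v) w : ℂ)) F (𝓝 z) := by
    obtain ⟨z, -, hz⟩ := (isCompact_closedBall (0 : ℂ) (C * ‖v‖ * ‖w‖)).ultrafilter_le_nhds
      (F.map fun i => (inner ℂ (T i v) w : ℂ))
      (by
        simp only [Ultrafilter.coe_map, le_principal_iff, mem_map]
        exact univ_mem' fun i => by simpa using hbound v w i)
    exact ⟨z, hz⟩
  choose b hb using hlim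
  -- Uniqueness of limits makes the limit form sesquilinear; being bounded, it is represented by an
  -- operator.
  let B : H →ₗ⋆[ℂ] H →ₗ[ℂ] ℂ := LinearMap.mk₂'ₛₗ _ _ b
    (fun v v' w => tendsto_nhds_unique (hb _ _) <| by
      simpa only [map_add, inner_add_left] using (hb v w).add (hb v' w))
    (fun r v w => tendsto_nhds_unique (hb _ _) <| by
      simpa only [map_smul, inner_smul_left, smul_eq_mul] using (hb v w).const_smul (starRingEnd ℂ r))
    (fun v w w' => tendsto_nhds_unique (hb _ _) <| by
      simpa only [inner_add_right] using (hb v w).add (hb v w'))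
    (fun r v w => tendsto_nhds_unique (hb _ _) <| by
      simpa only [inner_smul_right, smul_eq_mul, RingHom.id_apply] using (hb v w).const_smul r)
  have hB (v w : H) : ‖B v w‖ ≤ C * ‖v‖ * ‖w‖ :=
    le_of_tendsto (hb v w).norm (Eventually.of_forall (hbound v w))
  refine ⟨InnerProductSpace.continuousLinearMapOfBilin (B.mkContinuous₂ C hB), fun ξ η => ?_⟩
  have h1 : (inner ℂ (InnerProductSpace.continuousLinearMapOfBilin (B.mkContinuous₂ C hB) η) ξ : ℂ)
      = b η ξ := by
    rw [InnerProductSpace.continuousLinearMapOfBilin_apply]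
    rfl
  have h2 := (Complex.continuous_conj.tendsto _).comp (hb η ξ)
  rw [← inner_conj_symm, h1]
  simpa only [Function.comp_def, inner_conj_symm] using h2

end WeakOperatorLimits

/-! ### Completely positive maps: averages, contractivity, limits. -/

namespace CompletelyPositiveMap

open scoped ComplexOrder

variable {H : Type*} [NormedAddCommGroup H] [InnerProductSpace ℂ H] [CompleteSpace H]

theorem sum_inner_map_nonneg (φ : (H →L[ℂ] H) →CP (H →L[ℂ] H)) {n : Type*} [Fintype n]
    {M : CStarMatrix n n (H →L[ℂ] H)} (hM : 0 ≤ M) (ξ : n → H) :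
    0 ≤ ∑ i, ∑ j, inner ℂ (ξ i) (φ (M i j) (ξ j)) :=
  CStarMatrix.sum_inner_nonneg (φ.map_cstarMatrix_nonneg M hM) ξ

/-- A linear map on `B(H)` is completely positive as soon as it turns nonnegative operator matrices
into matrices with nonnegative sesquilinear form. -/
def ofSumInnerNonneg (φ : (H →L[ℂ] H) →ₗ[ℂ] (H →L[ℂ] H))
    (h : ∀ (k : ℕ) (M : CStarMatrix (Fin k) (Fin k) (H →L[ℂ] H)), 0 ≤ M → ∀ ξ : Fin k → H,
      0 ≤ ∑ i, ∑ j, inner ℂ (ξ i) (φ (M i j) (ξ j))) : (H →L[ℂ] H) →CP (H →L[ℂ] H) where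
  toLinearMap := φ
  map_cstarMatrix_nonneg' k M hM := (CStarMatrix.nonneg_iff_inner _).mpr (h k M hM)

@[simp]
theorem ofSumInnerNonneg_apply (φ : (H →L[ℂ] H) →ₗ[ℂ] (H →L[ℂ] H)) (h) (x : H →L[ℂ] H) :
    ofSumInnerNonneg φ h x = φ x := rfl

/-- The identity as a completely positive map. -/
def id (A : Type*) [NonUnitalCStarAlgebra A] [PartialOrder A] [StarOrderedRing A] : A →CP A where
  toLinearMap := LinearMap.id
  map_cstarMatrix_nonneg' _ _ hM := hM

@[simp]
theorem id_apply {A : Type*} [NonUnitalCStarAlgebra A] [PartialOrder A] [StarOrderedRing A]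
    (x : A) : id A x = x := rfl

/-- The composition of completely positive maps. -/
def comp {A B C : Type*} [NonUnitalCStarAlgebra A] [PartialOrder A] [StarOrderedRing A]
    [NonUnitalCStarAlgebra B] [PartialOrder B] [StarOrderedRing B]
    [NonUnitalCStarAlgebra C] [PartialOrder C] [StarOrderedRing C]
    (ψ : B →CP C) (φ : A →CP B) : A →CP C where
  toLinearMap := ψ.toLinearMap ∘ₗ φ.toLinearMap
  map_cstarMatrix_nonneg' k M hM :=
    ψ.map_cstarMatrix_nonneg' k _ (φ.map_cstarMatrix_nonneg' k M hM)

@[simp]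
theorem comp_apply {A B C : Type*} [NonUnitalCStarAlgebra A] [PartialOrder A] [StarOrderedRing A]
    [NonUnitalCStarAlgebra B] [PartialOrder B] [StarOrderedRing B]
    [NonUnitalCStarAlgebra C] [PartialOrder C] [StarOrderedRing C]
    (ψ : B →CP C) (φ : A →CP B) (x : A) : ψ.comp φ x = ψ (φ x) := rfl

/-- The average of a finite sequence of completely positive maps on `B(H)`. -/
noncomputable def average (φ : ℕ → (H →L[ℂ] H) →CP (H →L[ℂ] H)) (n : ℕ) :
    (H →L[ℂ] H) →CP (H →L[ℂ] H) :=
  ofSumInnerNonneg ((n : ℂ)⁻¹ • ∑ k ∈ Finset.range n, (φ k).toLinearMap) fun m M hM ξ => by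
    have h : ∑ i, ∑ j, inner ℂ (ξ i)
        (((n : ℂ)⁻¹ • ∑ k ∈ Finset.range n, (φ k).toLinearMap) (M i j) (ξ j)) =
        (n : ℂ)⁻¹ * ∑ k ∈ Finset.range n, ∑ i, ∑ j, inner ℂ (ξ i) (φ k (M i j) (ξ j)) := by
      simp only [LinearMap.smul_apply, LinearMap.sum_apply, smul_apply, sum_apply,
        inner_smul_right, inner_sum, Finset.mul_sum]
      rw [Finset.sum_comm_cycle]
      rfl
    rw [h]
    exact mul_nonneg (by simp) (Finset.sum_nonneg fun k _ => (φ k).sum_inner_map_nonneg hM ξ)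

theorem average_apply (φ : ℕ → (H →L[ℂ] H) →CP (H →L[ℂ] H)) (n : ℕ) (x : H →L[ℂ] H) :
    average φ n x = (n : ℂ)⁻¹ • ∑ k ∈ Finset.range n, φ k x := by
  simp only [average, ofSumInnerNonneg_apply, LinearMap.smul_apply, LinearMap.sum_apply]
  rfl

/-- Unital completely positive maps on `B(H)` are contractive. -/
theorem norm_apply_le_of_map_one {φ : (H →L[ℂ] H) →CP (H →L[ℂ] H)} (hφ : φ 1 = 1)
    (x : H →L[ℂ] H) : ‖φ x‖ ≤ ‖x‖ := by
  -- The positive matrix with diagonal `‖x‖` and off-diagonal entries `x`, `x*`; its image under `φ`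
  -- keeps the diagonal since `φ 1 = 1`.
  let M : CStarMatrix (Fin 2) (Fin 2) (H →L[ℂ] H) :=
    CStarMatrix.ofMatrix !![(‖x‖ : ℂ) • 1, x; star x, (‖x‖ : ℂ) • 1]
  have hM : 0 ≤ M := by
    rw [CStarMatrix.nonneg_iff_inner]
    intro ξ
    have h : ∑ i, ∑ j, inner ℂ (ξ i) (M i j (ξ j)) =
        ((‖x‖ * ‖ξ 0‖ ^ 2 + 2 * (inner ℂ (ξ 0) (x (ξ 1))).re + ‖x‖ * ‖ξ 1‖ ^ 2 : ℝ) : ℂ) := by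
      have h1 : (inner ℂ (x (ξ 1)) (ξ 0) : ℂ) = starRingEnd ℂ (inner ℂ (ξ 0) (x (ξ 1))) :=
        (inner_conj_symm _ _).symm
      have h2 := Complex.add_conj (inner ℂ (ξ 0) (x (ξ 1)))
      simp [M, Fin.sum_univ_two, inner_self_eq_norm_sq_to_K, ContinuousLinearMap.star_eq_adjoint,
        ContinuousLinearMap.adjoint_inner_right]
      push_cast at h2
      linear_combination h1 + h2
    rw [h]
    apply Complex.zero_le_real.mpr
    have h3 : |(inner ℂ (ξ 0) (x (ξ 1)) : ℂ).re| ≤ ‖ξ 0‖ * (‖x‖ * ‖ξ 1‖) :=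
      (Complex.abs_re_le_norm _).trans <| (norm_inner_le_norm _ _).trans <| by
        gcongr
        exact x.le_opNorm _
    have := neg_le_of_abs_le h3
    nlinarith [mul_nonneg (norm_nonneg x) (sq_nonneg (‖ξ 0‖ - ‖ξ 1‖))]
  have key (a b : H) : 0 ≤ (‖x‖ * ‖a‖ ^ 2 + ‖x‖ * ‖b‖ ^ 2 : ℝ) +
      ((inner ℂ a (φ x b) : ℂ) + inner ℂ b (φ (star x) a)) := by
    have h := φ.sum_inner_map_nonneg hM ![a, b]
    simp [-Complex.coe_smul, M, Fin.sum_univ_two, hφ,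
      inner_self_eq_norm_sq_to_K] at h
    convert h using 1
    push_cast
    ring
  -- The vanishing imaginary part of `key` at `I • b` equates the real parts of the two cross terms,
  -- so `φ (star x) = star (φ x)` is not needed.
  have key' (a b : H) :
      0 ≤ ‖x‖ * ‖a‖ ^ 2 + ‖x‖ * ‖b‖ ^ 2 + 2 * (inner ℂ a (φ x b) : ℂ).re := by
    have h1 := Complex.nonneg_iff.mp (key a b)
    have h2 := Complex.nonneg_iff.mp (key a (Complex.I • b))
    simp [-Complex.ofReal_add, -Complex.ofReal_mul] at h1 h2
    linarith [h1.1, h2.2]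
  refine (φ x).opNorm_le_bound (norm_nonneg x) fun b => ?_
  -- Both vectors have norm `‖b‖ * ‖φ x b‖`, and the sign makes the cross term negative.
  have h := key' (-(‖b‖ : ℂ) • φ x b) ((‖φ x b‖ : ℂ) • b)
  simp only [map_smul, inner_smul_left, inner_smul_right, inner_self_eq_norm_sq_to_K,
    norm_smul] at h
  have h' : 0 ≤ (‖b‖ * ‖φ x b‖ ^ 2) * (‖x‖ * ‖b‖ - ‖φ x b‖) := by
    simp [← Complex.ofReal_pow] at h
    nlinarith
  rcases (norm_nonneg (φ x b)).eq_or_lt' with h0 | h0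
  · rw [h0]; positivity
  rcases (norm_nonneg b).eq_or_lt' with hb | hb
  · rw [norm_eq_zero.mp hb]; simp
  have := nonneg_of_mul_nonneg_right h' (by positivity)
  linarith

open Filter Topology in
/-- Unital completely positive maps on `B(H)` converge in the point-weak operator topology along
every ultrafilter. -/
theorem exists_tendsto_inner_of_ultrafilter {ι : Type*} (F : Ultrafilter ι)
    (φ : ι → (H →L[ℂ] H) →CP (H →L[ℂ] H)) (hφ : ∀ i, φ i 1 = 1) :
    ∃ ψ : (H →L[ℂ] H) →CP (H →L[ℂ] H), ∀ x ξ η,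
      Tendsto (fun i => (inner ℂ ξ (φ i x η) : ℂ)) F (𝓝 (inner ℂ ξ (ψ x η))) := by
  have hlim (x : H →L[ℂ] H) := ContinuousLinearMap.exists_tendsto_inner_of_ultrafilter F
    fun i => norm_apply_le_of_map_one (hφ i) x
  choose ψ hψ using hlim
  let ψₗ : (H →L[ℂ] H) →ₗ[ℂ] (H →L[ℂ] H) :=
    { toFun := ψ
      map_add' := fun x y => by
        ext η
        refine ext_inner_left ℂ fun ξ => tendsto_nhds_unique (hψ _ ξ η) ?_
        simpa only [map_add, add_apply, inner_add_right] using
          (hψ x ξ η).add (hψ y ξ η)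
      map_smul' := fun r x => by
        ext η
        refine ext_inner_left ℂ fun ξ => tendsto_nhds_unique (hψ _ ξ η) ?_
        simpa only [map_smul, smul_apply, inner_smul_right, smul_eq_mul,
            RingHom.id_apply] using
          (hψ x ξ η).const_smul r }
  refine ⟨ofSumInnerNonneg ψₗ fun k M hM ξ => ?_, hψ⟩
  exact ge_of_tendsto' (tendsto_finsetSum _ fun i _ => tendsto_finsetSum _ fun j _ =>
    hψ (M i j) (ξ i) (ξ j)) fun l => (φ l).sum_inner_map_nonneg hM ξ

end CompletelyPositiveMap

/-! ### Closure properties of `𝔐` and existence of minimal elements. -/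

namespace CovariantRep

open CompletelyPositiveMap

variable {G A : Type*} [Group G] [NonUnitalCStarAlgebra A] {α : G →* (A ≃⋆ₐ[ℂ] A)}
  {H : Type*} [NormedAddCommGroup H] [InnerProductSpace ℂ H] [CompleteSpace H]

theorem id_mem_gMaps (c : CovariantRep α H) : CompletelyPositiveMap.id (H →L[ℂ] H) ∈ c.gMaps :=
  ⟨⟨rfl, fun _ _ => rfl⟩, fun _ _ => rfl⟩

theorem comp_mem_gMaps {c : CovariantRep α H} {ψ φ : (H →L[ℂ] H) →CP (H →L[ℂ] H)}
    (hψ : ψ ∈ c.gMaps) (hφ : φ ∈ c.gMaps) : ψ.comp φ ∈ c.gMaps := by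
  refine ⟨⟨?_, fun g x => ?_⟩, fun x hx => ?_⟩
  · rw [comp_apply, hφ.1.1, hψ.1.1]
  · rw [comp_apply, hφ.1.2, hψ.1.2, comp_apply]
  · rw [comp_apply, hφ.2 x hx, hψ.2 x hx]

theorem Ad_smul (c : CovariantRep α H) (g : G) (r : ℂ) (x : H →L[ℂ] H) :
    c.Ad g (r • x) = r • c.Ad g x := by
  simp [Ad]

theorem Ad_sum (c : CovariantRep α H) (g : G) {ι : Type*} (s : Finset ι) (x : ι → H →L[ℂ] H) :
    c.Ad g (∑ i ∈ s, x i) = ∑ i ∈ s, c.Ad g (x i) := by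
  simp [Ad, Finset.mul_sum, Finset.sum_mul]

theorem average_mem_gMaps {c : CovariantRep α H} {φ : ℕ → (H →L[ℂ] H) →CP (H →L[ℂ] H)}
    (hφ : ∀ k, φ k ∈ c.gMaps) {n : ℕ} (hn : n ≠ 0) : average φ n ∈ c.gMaps := by
  have hn' : (n : ℂ) ≠ 0 := Nat.cast_ne_zero.mpr hn
  have hfix {x : H →L[ℂ] H} (hx : ∀ k, φ k x = x) : average φ n x = x := by
    rw [average_apply, Finset.sum_congr rfl fun k _ => hx k, Finset.sum_const, Finset.card_range,
      ← Nat.cast_smul_eq_nsmul ℂ, inv_smul_smul₀ hn']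
  refine ⟨⟨hfix fun k => (hφ k).1.1, fun g x => ?_⟩, fun x hx => hfix fun k => (hφ k).2 x hx⟩
  simp only [average_apply, (hφ _).1.2, Ad_smul, Ad_sum]

open Filter Topology in
theorem exists_tendsto_mem_gMaps (c : CovariantRep α H) {ι : Type*} (F : Ultrafilter ι)
    (φ : ι → (H →L[ℂ] H) →CP (H →L[ℂ] H)) (hφ : ∀ i, φ i ∈ c.gMaps) :
    ∃ ψ ∈ c.gMaps, ∀ x ξ η,
      Tendsto (fun i => (inner ℂ ξ (φ i x η) : ℂ)) F (𝓝 (inner ℂ ξ (ψ x η))) := by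
  obtain ⟨ψ, hψ⟩ := exists_tendsto_inner_of_ultrafilter F φ fun i => (hφ i).1.1
  have hfix {x : H →L[ℂ] H} (hx : ∀ i, φ i x = x) : ψ x = x := by
    ext η
    refine ext_inner_left ℂ fun ξ => tendsto_nhds_unique (hψ x ξ η) ?_
    simp only [hx, tendsto_const_nhds]
  refine ⟨ψ, ⟨⟨hfix fun i => (hφ i).1.1, fun g x => ?_⟩, fun x hx => hfix fun i => (hφ i).2 x hx⟩,
    hψ⟩
  -- Moving `u_g` onto the vectors lets equivariance pass to weak limits.
  have hAd (ξ η : H) (y : H →L[ℂ] H) : (inner ℂ ξ (c.Ad g y η) : ℂ) =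
      inner ℂ ((star (c.u g : H →L[ℂ] H)) ξ) (y ((star (c.u g : H →L[ℂ] H)) η)) := by
    rw [ContinuousLinearMap.star_eq_adjoint, ContinuousLinearMap.adjoint_inner_left]
    rfl
  ext η
  refine ext_inner_left ℂ fun ξ => tendsto_nhds_unique (hψ _ ξ η) ?_
  simp only [(hφ _).1.2, hAd]
  exact hψ x _ _

open Filter Topology in
theorem exists_isMinimalGMap (c : CovariantRep α H) : ∃ φ, c.IsMinimalGMap φ := by
  -- The order is reversed, so a maximal element for `r` is minimal in `𝔐`; a chain is bounded by
  -- its limit along an ultrafilter finer than its tails.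
  let r : c.gMaps → c.gMaps → Prop := fun φ ψ => ∀ x, ‖ψ.1 x‖ ≤ ‖φ.1 x‖
  have hr : ∀ {φ ψ θ}, r φ ψ → r ψ θ → r φ θ := fun h h' x => (h' x).trans (h x)
  have : Nonempty c.gMaps := ⟨⟨_, c.id_mem_gMaps⟩⟩
  obtain ⟨φ, hφ⟩ := exists_maximal_of_nonempty_chains_bounded (r := r) (fun s hs hne => by
    have := hne.to_subtype
    let : Preorder s :=
      { le := fun a b => r a b
        le_refl := fun _ _ => le_rfl
        le_trans := fun _ _ _ => hr }
    have : IsDirectedOrder s := ⟨fun a b => by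
      by_cases hab : (a : c.gMaps) = b
      · exact ⟨a, le_refl a, by rw [Subtype.ext hab]⟩
      · rcases hs a.2 b.2 hab with h | h
        · exact ⟨b, h, le_refl b⟩
        · exact ⟨a, le_refl a, h⟩⟩
    obtain ⟨ψ, hψ, hlim⟩ := c.exists_tendsto_mem_gMaps (Ultrafilter.of (atTop : Filter s))
      (fun a => a.1.1) fun a => a.1.2
    refine ⟨⟨ψ, hψ⟩, fun a ha x => ?_⟩
    refine ContinuousLinearMap.norm_le_of_tendsto_inner (norm_nonneg _) ?_ (hlim x)
    exact Ultrafilter.of_le (atTop : Filter s)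
      ((eventually_ge_atTop (⟨a, ha⟩ : s)).mono fun b (hb : r a b) => hb x)) hr
  exact ⟨φ.1, φ.2, fun ψ hψ h => hφ ⟨ψ, hψ⟩ h⟩

/-! ### Averaging and rigidity. -/

/-- Iterates start at exponent 1, because the identity need not lie below `φ`. -/
theorem exists_mem_gMaps_eq_iterate {c : CovariantRep α H} {θ φ : (H →L[ℂ] H) →CP (H →L[ℂ] H)}
    (hθ : θ ∈ c.gMaps) (hle : ∀ x, ‖θ x‖ ≤ ‖φ x‖) (k : ℕ) :
    ∃ ρ ∈ c.gMaps, (∀ x, ρ x = θ^[k + 1] x) ∧ ∀ x, ‖ρ x‖ ≤ ‖φ x‖ := by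
  induction k with
  | zero => exact ⟨θ, hθ, fun x => rfl, hle⟩
  | succ k ih =>
    obtain ⟨ρ, hρ, hρθ, hρφ⟩ := ih
    refine ⟨θ.comp ρ, comp_mem_gMaps hθ hρ, fun x => ?_, fun x => ?_⟩
    · rw [comp_apply, hρθ, ← Function.iterate_succ_apply' θ]
    · exact (norm_apply_le_of_map_one hθ.1.1 _).trans (hρφ x)

/-- A minimal `G`-map does not distinguish `x` from `θ x` if `θ` is below it. -/
theorem IsMinimalGMap.apply_apply_eq {c : CovariantRep α H}
    {φ θ : (H →L[ℂ] H) →CP (H →L[ℂ] H)} (hφ : c.IsMinimalGMap φ) (hθ : θ ∈ c.gMaps)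
    (hle : ∀ x, ‖θ x‖ ≤ ‖φ x‖) (x : H →L[ℂ] H) : φ (θ x) = φ x := by
  choose ρ hρ hρθ hρφ using exists_mem_gMaps_eq_iterate hθ hle
  have hbound (n : ℕ) : ‖φ (x - θ x)‖ ≤ 2 * ‖x‖ * (1 / ((n : ℝ) + 1)) := by
    have hmem := average_mem_gMaps hρ (Nat.succ_ne_zero n)
    have hn : ‖((n + 1 : ℕ) : ℂ)⁻¹‖ = 1 / ((n : ℝ) + 1) := by
      rw [norm_inv, Complex.norm_natCast, one_div]
      push_cast
      rfl
    have hn' : ‖((n + 1 : ℕ) : ℂ)⁻¹‖ * ((n + 1 : ℕ) : ℝ) = 1 := by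
      rw [hn]
      push_cast
      field_simp
    have hleavg (y : H →L[ℂ] H) : ‖average ρ (n + 1) y‖ ≤ ‖φ y‖ := by
      rw [average_apply, norm_smul]
      calc ‖((n + 1 : ℕ) : ℂ)⁻¹‖ * ‖∑ k ∈ Finset.range (n + 1), ρ k y‖
          ≤ ‖((n + 1 : ℕ) : ℂ)⁻¹‖ * (((n + 1 : ℕ) : ℝ) * ‖φ y‖) := by
            gcongr
            refine (norm_sum_le_of_le _ fun k _ => hρφ k y).trans ?_
            simp
        _ = ‖φ y‖ := by rw [← mul_assoc, hn', one_mul]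
    refine (hφ.2 _ hmem hleavg _).trans ?_
    -- Only the two end terms survive, each of norm at most `‖x‖`; hence the constant `2 * ‖x‖`.
    have htel : ∑ k ∈ Finset.range (n + 1), ρ k (x - θ x) = θ x - ρ (n + 1) x := by
      have h (k : ℕ) : ρ k (x - θ x) = ρ k x - ρ (k + 1) x := by
        rw [map_sub, hρθ k (θ x), ← Function.iterate_succ_apply θ, ← hρθ (k + 1)]
      rw [Finset.sum_congr rfl fun k _ => h k, Finset.sum_range_sub' (fun k => ρ k x), hρθ 0 x]
      rfl
    rw [average_apply, htel, norm_smul, hn, mul_comm]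
    gcongr
    have h1 := norm_apply_le_of_map_one hθ.1.1 x
    have h2 := norm_apply_le_of_map_one (hρ (n + 1)).1.1 x
    linarith [norm_sub_le (θ x) (ρ (n + 1) x)]
  have hlim := (tendsto_one_div_add_atTop_nhds_zero_nat (𝕜 := ℝ)).const_mul (2 * ‖x‖)
  rw [mul_zero] at hlim
  have h0 := norm_le_zero_iff.mp (ge_of_tendsto' hlim hbound)
  rw [map_sub, sub_eq_zero] at h0
  exact h0.symm

theorem IsMinimalGMap.idempotent {c : CovariantRep α H} {φ : (H →L[ℂ] H) →CP (H →L[ℂ] H)}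
    (hφ : c.IsMinimalGMap φ) (x : H →L[ℂ] H) : φ (φ x) = φ x :=
  hφ.apply_apply_eq hφ.1 (fun _ => le_rfl) x

/-- Rigidity: a minimal `G`-map composed with any member of `𝔐` is the identity on the
boundary. -/
theorem IsMinimalGMap.apply_apply_of_mem_boundary {c : CovariantRep α H}
    {φ ψ : (H →L[ℂ] H) →CP (H →L[ℂ] H)} (hφ : c.IsMinimalGMap φ) (hψ : ψ ∈ c.gMaps)
    {y : H →L[ℂ] H} (hy : y ∈ boundary φ) : φ (ψ y) = y := by
  obtain ⟨x, rfl⟩ := hy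
  change φ (ψ (φ x)) = φ x
  -- `φ ∘ ψ ∘ φ` lies below `φ` because `φ` and `ψ` are contractive.
  have h := hφ.apply_apply_eq (comp_mem_gMaps hφ.1 (comp_mem_gMaps hψ hφ.1))
    (fun z => (norm_apply_le_of_map_one hφ.1.1.1 _).trans
      (norm_apply_le_of_map_one hψ.1.1 _)) x
  rwa [comp_apply, comp_apply, hφ.idempotent] at h

/-! ### Trivial action, amenability and the radical. -/

theorem Ad_eq_self_iff (c : CovariantRep α H) (g : G) (x : H →L[ℂ] H) :
    c.Ad g x = x ↔ (c.u g : H →L[ℂ] H) * x = x * (c.u g : H →L[ℂ] H) := by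
  constructor
  · intro h
    nth_rw 2 [← h]
    simp [Ad, mul_assoc]
  · intro h
    simp [Ad, h, mul_assoc]

theorem mem_commutant_iff (c : CovariantRep α H) (Λ : Subgroup G) (x : H →L[ℂ] H) :
    x ∈ c.commutant Λ ↔ ∀ g ∈ Λ, c.Ad g x = x := by
  simp only [commutant, Set.mem_centralizer_iff, Ad_eq_self_iff]
  exact ⟨fun h g hg => h _ ⟨g, hg, rfl⟩, fun h _ ⟨g, hg, hgx⟩ => hgx ▸ h g hg⟩

theorem IsMinimalGMap.forall_boundaryAction_eq_iff {c : CovariantRep α H}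
    {φ : (H →L[ℂ] H) →CP (H →L[ℂ] H)} (hφ : c.IsMinimalGMap φ) (Λ : Subgroup G) :
    (∀ g ∈ Λ, ∀ x : boundary φ, c.boundaryAction φ hφ.1.1 g x = x) ↔ c.IsAmenable Λ := by
  constructor
  · intro h
    refine ⟨φ, hφ.1, fun x => (c.mem_commutant_iff Λ _).mpr fun g hg => ?_⟩
    exact congrArg Subtype.val (h g hg ⟨φ x, x, rfl⟩)
  · rintro ⟨ψ, hψ, hψΛ⟩ g hg ⟨y, hy⟩
    refine Subtype.ext ?_
    change c.Ad g y = y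
    calc c.Ad g y = φ (c.Ad g (ψ y)) := by
          rw [hφ.1.1.2, hφ.apply_apply_of_mem_boundary hψ hy]
      _ = y := by
          rw [(c.mem_commutant_iff Λ _).mp (hψΛ y) g hg, hφ.apply_apply_of_mem_boundary hψ hy]

theorem IsMinimalGMap.isGreatest_ker {c : CovariantRep α H}
    {φ : (H →L[ℂ] H) →CP (H →L[ℂ] H)} (hφ : c.IsMinimalGMap φ) :
    IsGreatest c.amenableNormalSubgroups (c.boundaryAction φ hφ.1.1).ker := by
  refine ⟨⟨MonoidHom.normal_ker _, ?_⟩, fun Λ hΛ g hg => ?_⟩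
  · refine (hφ.forall_boundaryAction_eq_iff _).mp fun g hg x => ?_
    rw [MonoidHom.mem_ker.mp hg]
    rfl
  · refine MonoidHom.mem_ker.mpr (LinearMap.ext fun x => ?_)
    exact (hφ.forall_boundaryAction_eq_iff Λ).mpr hΛ.2 g hg x

theorem isAmenableRadical_of_isGreatest {c : CovariantRep α H} {R : Subgroup G}
    (hR : IsGreatest c.amenableNormalSubgroups R) : c.IsAmenableRadical R :=
  ⟨⟨hR.1, fun _ hΛ _ => hR.2 hΛ⟩, fun _ hΛ => hΛ.eq_of_le hR.1 (hR.2 hΛ.prop)⟩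

end CovariantRep

theorem lemma4p4 {G A : Type*} [Group G] [NonUnitalCStarAlgebra A] (α : G →* (A ≃⋆ₐ[ℂ] A))
    {H : Type*} [NormedAddCommGroup H] [InnerProductSpace ℂ H] [CompleteSpace H]
    (c : CovariantRep α H) :
    (∃ φ, c.IsMinimalGMap φ) ∧
    ∀ (φ : (H →L[ℂ] H) →CP (H →L[ℂ] H)) (hφ : c.IsMinimalGMap φ),
      (∀ Λ : Subgroup G, Λ.Normal →
        ((∀ g ∈ Λ, ∀ x : CovariantRep.boundary φ, c.boundaryAction φ hφ.1.1 g x = x) ↔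
          c.IsAmenable Λ)) ∧
      IsGreatest c.amenableNormalSubgroups (c.boundaryAction φ hφ.1.1).ker ∧
      c.IsAmenableRadical (c.boundaryAction φ hφ.1.1).ker := by
  exact ⟨c.exists_isMinimalGMap, fun φ hφ => ⟨fun Λ _ => hφ.forall_boundaryAction_eq_iff Λ,
    hφ.isGreatest_ker, CovariantRep.isAmenableRadical_of_isGreatest hφ.isGreatest_ker⟩⟩
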